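/- Let $q\in(0,1]$. Let $R(SO_q(3))$ denote the fusion algebra of the quantum group $SO_q(3)$: its set of irreducible objects is $I=\mathbb{Z}_{+}=\{0,1,2,\dots\}$ with unit $e=0$ and trivial involution, its multiplication on $\mathbb{Z}[I]$ is given by the fusion rules \[ m\otimes n=|m-n|\oplus(|m-n|+1)\oplus\cdots\oplus(m+n),\qquad m,n\in\mathbb{Z}_+, \] and it is equipped with the quantum dimension function $d(n)=[2n+1]_q$, where $[k]_q=\frac{q^{-k}-q^{k}}{q^{-1}-q}$ for $q<1$ and $[k]_1=k$. A finite set $X\subseteq I$ (closed under the involution) is generating if every $\alpha\in I$ is contained in (occurs with non-zero coefficient in) a product $x_1\cdots x_n$ with $n\ge 1$ and $x_1,\dots,x_n\in X$. For such an $X$ let $\ell_X(e)=0$ and, for $\alpha\ne e$, let $\ell_X(\alpha)$ be the least such $n\ge 1$; put $B_X(n)=\{\alpha\in I:\ell_X(\alpha)\le n\}$ and $|A|=\sum_{\alpha\in A}d(\alpha)^2$ for finite $A\subseteq I$. The exponential growth rate with respect to $X$ is $\omega_X=\lim_{n\to\infty}\sqrt[n]{|B_X(n)|}$, and the uniform exponential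 growth rate is $\omega=\inf_X\omega_X$, where $X$ runs over all finite generating sets. Then, for every finite generating set $X$, all balls $B_X(n)$ are finite and the limit $\omega_X$ exists; the uniform exponential growth rate of $R(SO_q(3))$ is $\omega(R(SO_q(3)))=q^{-4}$; and this value is attained at the generating set $\{1\}$, i.e. $\{1\}$ is generating and $\omega_{\{1\}}(R(SO_q(3)))=q^{-4}$. -/

import Mathlib

open Filter Topology

/-- A fusion algebra `(R, d)` with set of irreducible objects `I`.  Its underlying abelian group is
the free abelian group `ℤ[I] = I →₀ ℤ`; the irreducible object `α` is the basis vector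
`Finsupp.single α 1`. -/
structure FusionAlgebra (I : Type*) where
  /-- the distinguished irreducible object -/
  e : I
  /-- the involution on irreducible objects -/
  bar : I → I
  bar_bar : ∀ α, bar (bar α) = α
  /-- the (biadditive) multiplication of the ring `R = ℤ[I]` -/
  mul : (I →₀ ℤ) →ₗ[ℤ] (I →₀ ℤ) →ₗ[ℤ] (I →₀ ℤ)
  mul_assoc : ∀ x y z, mul (mul x y) z = mul x (mul y z)
  one_mul : ∀ x, mul (Finsupp.single e 1) x = x
  mul_one : ∀ x, mul x (Finsupp.single e 1) = x
  /-- the structure constants `N_{ξ,η}^α` are non-negative -/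
  mul_nonneg : ∀ ξ η α, 0 ≤ mul (Finsupp.single ξ 1) (Finsupp.single η 1) α
  /-- the `ℤ`-linear extension of the involution is antimultiplicative -/
  bar_mul : ∀ x y, Finsupp.mapDomain bar (mul x y) =
    mul (Finsupp.mapDomain bar y) (Finsupp.mapDomain bar x)
  /-- Frobenius reciprocity, `N_{ξ,η}^α = N_{α,η̄}^ξ` -/
  frobenius_left : ∀ ξ η α, mul (Finsupp.single ξ 1) (Finsupp.single η 1) α =
    mul (Finsupp.single α 1) (Finsupp.single (bar η) 1) ξ
  /-- Frobenius reciprocity, `N_{ξ,η}^α = N_{ξ̄,α}^η` -/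
  frobenius_right : ∀ ξ η α, mul (Finsupp.single ξ 1) (Finsupp.single η 1) α =
    mul (Finsupp.single (bar ξ) 1) (Finsupp.single α 1) η
  /-- the dimension function -/
  dim : (I →₀ ℤ) →ₗ[ℤ] ℝ
  dim_mul : ∀ x y, dim (mul x y) = dim x * dim y
  dim_bar : ∀ α, dim (Finsupp.single (bar α) 1) = dim (Finsupp.single α 1)
  one_le_dim : ∀ α, 1 ≤ dim (Finsupp.single α 1)

namespace FusionAlgebra

variable {I : Type*} (F : FusionAlgebra I)

/-- The dimension `d(α)` of an irreducible object. -/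
noncomputable def d (α : I) : ℝ := F.dim (Finsupp.single α 1)

/-- The product `x₁ ⋯ xₙ` in `R` of a list of irreducible objects. -/
noncomputable def prod (l : List I) : I →₀ ℤ :=
  l.foldr (fun x r => F.mul (Finsupp.single x 1) r) (Finsupp.single F.e 1)

/-- `α ⊆ x₁ ⋯ xₙ` for some `x₁, …, xₙ ∈ X`. -/
def ContainedInPower (X : Finset I) (n : ℕ) (α : I) : Prop :=
  ∃ l : List I, l.length = n ∧ (∀ x ∈ l, x ∈ X) ∧ α ∈ (F.prod l).support

/-- `X` is a (finite, symmetric) generating set. -/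
def Generates (X : Finset I) : Prop :=
  (∀ x ∈ X, F.bar x ∈ X) ∧ ∀ α, ∃ n, 1 ≤ n ∧ F.ContainedInPower X n α

open Classical in
/-- The length function `ℓ_X` (of a generating set). -/
noncomputable def length (X : Finset I) (α : I) : ℕ :=
  if α = F.e then 0 else sInf {n | 1 ≤ n ∧ F.ContainedInPower X n α}

/-- The ball `B_X(n)` (of a generating set). -/
def ball (X : Finset I) (n : ℕ) : Set I := {α | F.length X α ≤ n}

/-- The size `|A| = ∑_{α ∈ A} d(α)²` of a finite set `A`. -/
noncomputable def size (A : Set I) : ℝ := ∑ᶠ α ∈ A, F.d α ^ 2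

/-- The `n`-th root of the size of the ball of radius `n`. -/
noncomputable def ballRoot (X : Finset I) (n : ℕ) : ℝ := F.size (F.ball X n) ^ (1 / (n : ℝ))

/-- The exponential growth rate `ω_X(R, d)` with respect to `X`. -/
noncomputable def growthRate (X : Finset I) : ℝ := limUnder atTop (F.ballRoot X)

/-- The set of all exponential growth rates `ω_X(R, d)`, `X` a finite generating set. -/
def growthRates : Set ℝ := {w | ∃ X : Finset I, F.Generates X ∧ w = F.growthRate X}

/-- The uniform exponential growth rate `ω(R, d)`. -/
noncomputable def uniformGrowthRate : ℝ := sInf F.growthRates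

end FusionAlgebra

/-- The `q`-number `[n]_q`, for a natural number `n`. -/
noncomputable def qNumber (q : ℝ) (n : ℕ) : ℝ :=
  if q = 1 then n else (q⁻¹ ^ n - q ^ n) / (q⁻¹ - q)

/-- The fusion rules of `SO_q(3)`:
`m ⊗ n = |m - n| ⊕ (|m - n| + 1) ⊕ ⋯ ⊕ (m + n)`. -/
noncomputable def fusionSO3 (m n : ℕ) : ℕ →₀ ℤ :=
  ∑ k ∈ Finset.Icc (Nat.dist m n) (m + n), Finsupp.single k 1

/-- The biadditive extension of the fusion rules to `ℤ[ℕ]`. -/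
noncomputable def mulSO3 : (ℕ →₀ ℤ) →ₗ[ℤ] (ℕ →₀ ℤ) →ₗ[ℤ] (ℕ →₀ ℤ) :=
  Finsupp.linearCombination ℤ (fun m => Finsupp.linearCombination ℤ (fun n => fusionSO3 m n))

/-- The quantum dimension function of `SO_q(3)`, extended linearly: `d(n) = [2n+1]_q`. -/
noncomputable def dimSOq3 (q : ℝ) : (ℕ →₀ ℤ) →ₗ[ℤ] ℝ :=
  Finsupp.linearCombination ℤ (fun n => qNumber q (2 * n + 1))

theorem mulSO3_single (m n : ℕ) :
    mulSO3 (Finsupp.single m 1) (Finsupp.single n 1) = fusionSO3 m n := by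
  simp [mulSO3]

theorem fusionSO3_apply (m n k : ℕ) :
    fusionSO3 m n k = if k ∈ Finset.Icc (Nat.dist m n) (m + n) then 1 else 0 := by
  simp [fusionSO3, Finsupp.finsetSum_apply, Finsupp.single_apply]

theorem fusionSO3_comm (m n : ℕ) : fusionSO3 m n = fusionSO3 n m := by
  simp [fusionSO3, Nat.dist_comm, add_comm]

theorem mulSO3_comm (x y : ℕ →₀ ℤ) : mulSO3 x y = mulSO3 y x := by
  have h : mulSO3 = mulSO3.flip := by
    ext m n : 4
    simp only [LinearMap.comp_apply, Finsupp.lsingle_apply, LinearMap.flip_apply, mulSO3_single]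
    exact fusionSO3_comm m n
  exact LinearMap.congr_fun₂ h x y

theorem mulSO3_assoc_single (m n k : ℕ) :
    mulSO3 (fusionSO3 m n) (Finsupp.single k 1) = mulSO3 (Finsupp.single m 1) (fusionSO3 n k) := by
  ext l
  have e1 : mulSO3 (fusionSO3 m n) (Finsupp.single k 1) l =
      ((Finset.Icc (max (Nat.dist m n) (Nat.dist k l)) (min (m + n) (k + l))).card : ℤ) := by
    rw [fusionSO3, map_sum, LinearMap.sum_apply, Finsupp.finsetSum_apply]
    simp only [mulSO3_single, fusionSO3_apply]
    rw [Finset.sum_boole]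
    congr 2
    ext j
    simp only [Finset.mem_filter, Finset.mem_Icc, Nat.dist]
    omega
  have e2 : mulSO3 (Finsupp.single m 1) (fusionSO3 n k) l =
      ((Finset.Icc (max (Nat.dist n k) (Nat.dist m l)) (min (n + k) (m + l))).card : ℤ) := by
    rw [fusionSO3, map_sum, Finsupp.finsetSum_apply]
    simp only [mulSO3_single, fusionSO3_apply]
    rw [Finset.sum_boole]
    congr 2
    ext j
    simp only [Finset.mem_filter, Finset.mem_Icc, Nat.dist]
    omega
  rw [e1, e2, Nat.card_Icc, Nat.card_Icc]
  congr 1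
  rcases le_total m n with h1 | h1 <;> rcases le_total k l with h2 | h2 <;>
    rcases le_total n k with h3 | h3 <;> rcases le_total m l with h4 | h4 <;>
    simp only [h1, h2, h3, h4, Nat.dist_eq_sub_of_le, Nat.dist_eq_sub_of_le_right] <;>
    omega

theorem mulSO3_assoc (x y z : ℕ →₀ ℤ) :
    mulSO3 (mulSO3 x y) z = mulSO3 x (mulSO3 y z) := by
  induction x using Finsupp.induction_linear with
  | zero => simp
  | add a b ha hb => simp [ha, hb]
  | single m a =>
    induction y using Finsupp.induction_linear with
    | zero => simp
    | add a b ha hb => simp [ha, hb]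
    | single n b =>
      induction z using Finsupp.induction_linear with
      | zero => simp
      | add a b ha hb => simp [ha, hb]
      | single k c =>
        have h (i : ℕ) (t : ℤ) : Finsupp.single i t = t • Finsupp.single i (1 : ℤ) := by simp
        rw [h m, h n, h k]
        simp only [map_smul, LinearMap.smul_apply, mulSO3_single, mulSO3_assoc_single]

theorem mulSO3_one (x : ℕ →₀ ℤ) : mulSO3 x (Finsupp.single 0 1) = x := by
  induction x using Finsupp.induction_linear with
  | zero => simp
  | add a b ha hb => simp [ha, hb]
  | single m a =>
    have h : Finsupp.single m a = a • Finsupp.single m (1 : ℤ) := by simp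
    rw [h, map_smul, LinearMap.smul_apply, mulSO3_single]
    simp [fusionSO3, Nat.dist]

theorem sum_Icc_telescope (f c : ℕ → ℝ) (h : ∀ k, f k = c (k + 1) - c k) (a b : ℕ) (hab : a ≤ b) :
    ∑ k ∈ Finset.Icc a b, f k = c (b + 1) - c a := by
  induction b, hab using Nat.le_induction with
  | base => simp [h]
  | succ b hb ih => rw [Finset.sum_Icc_succ_top (by omega), ih, h]; ring

theorem qNumber_mul (q : ℝ) (hq : q ∈ Set.Ioc (0 : ℝ) 1) (m n : ℕ) :
    ∑ k ∈ Finset.Icc (Nat.dist m n) (m + n), qNumber q (2 * k + 1) =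
      qNumber q (2 * m + 1) * qNumber q (2 * n + 1) := by
  wlog hmn : n ≤ m generalizing m n
  · rw [Nat.dist_comm, add_comm m n, this n m (by omega), mul_comm]
  obtain ⟨r, rfl⟩ := Nat.exists_eq_add_of_le hmn
  have hd : Nat.dist (n + r) n = r := by simp [Nat.dist]
  rw [hd]
  rcases eq_or_ne q 1 with rfl | h1
  · rw [sum_Icc_telescope _ (fun k => (k : ℝ) ^ 2) _ _ _ (by omega)]
    · simp only [qNumber, if_true]
      push_cast
      ring
    · intro k
      simp only [qNumber, if_true]
      push_cast
      ring
  · have hq0 : q ≠ 0 := hq.1.ne'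
    have hlt : q < 1 := lt_of_le_of_ne hq.2 h1
    have hD : q⁻¹ - q ≠ 0 := by
      have := one_lt_inv_iff₀.mpr ⟨hq.1, hlt⟩
      linarith
    have hp : q⁻¹ * q = 1 := inv_mul_cancel₀ hq0
    set p := q⁻¹ with hpdef
    have hpow (j : ℕ) : p ^ j * q ^ j = 1 := by rw [← mul_pow, hp, one_pow]
    rw [sum_Icc_telescope _ (fun k => (p ^ (2 * k) + q ^ (2 * k)) / (p - q) ^ 2) _ _ _ (by omega)]
    · simp only [qNumber, if_neg h1, ← hpdef]
      field_simp
      have h2 := hpow (2 * n + 1)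
      have e1 : p ^ (2 * (n + r) + 1) = p ^ (2 * n + 1) * p ^ (2 * r) := by ring
      have e2 : q ^ (2 * (n + r) + 1) = q ^ (2 * n + 1) * q ^ (2 * r) := by ring
      have e3 : p ^ (2 * (n + r + n + 1)) = p ^ (2 * n + 1) * p ^ (2 * n + 1) * p ^ (2 * r) := by
        ring
      have e4 : q ^ (2 * (n + r + n + 1)) = q ^ (2 * n + 1) * q ^ (2 * n + 1) * q ^ (2 * r) := by
        ring
      rw [e1, e2, e3, e4]
      linear_combination (p ^ (2 * r) + q ^ (2 * r)) * h2
    · intro k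
      simp only [qNumber, if_neg h1, ← hpdef]
      field_simp
      have e1 : p ^ (2 * (k + 1)) = p ^ (2 * k) * p ^ 2 := by ring
      have e2 : q ^ (2 * (k + 1)) = q ^ (2 * k) * q ^ 2 := by ring
      rw [e1, e2]
      have e3 : p ^ (2 * k + 1) = p ^ (2 * k) * p := by ring
      have e4 : q ^ (2 * k + 1) = q ^ (2 * k) * q := by ring
      rw [e3, e4]
      linear_combination (-(p ^ (2 * k)) - q ^ (2 * k)) * hp

theorem one_le_qNumber (q : ℝ) (hq : q ∈ Set.Ioc (0 : ℝ) 1) (n : ℕ) :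
    1 ≤ qNumber q (2 * n + 1) := by
  rcases eq_or_ne q 1 with rfl | h1
  · simp only [qNumber, if_true]
    push_cast
    have : (0 : ℝ) ≤ n := n.cast_nonneg
    linarith
  · have hlt : q < 1 := lt_of_le_of_ne hq.2 h1
    have hinv := one_lt_inv_iff₀.mpr ⟨hq.1, hlt⟩
    rw [qNumber, if_neg h1, one_le_div (by linarith)]
    have a1 : q⁻¹ ≤ q⁻¹ ^ (2 * n + 1) := le_self_pow₀ hinv.le (by omega)
    have a2 : q ^ (2 * n + 1) ≤ q := pow_le_of_le_one hq.1.le hq.2 (by omega)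
    linarith

theorem dimSOq3_single (q : ℝ) (n : ℕ) :
    dimSOq3 q (Finsupp.single n 1) = qNumber q (2 * n + 1) := by
  simp [dimSOq3]

theorem dimSOq3_mul (q : ℝ) (hq : q ∈ Set.Ioc (0 : ℝ) 1) (x y : ℕ →₀ ℤ) :
    dimSOq3 q (mulSO3 x y) = dimSOq3 q x * dimSOq3 q y := by
  induction x using Finsupp.induction_linear with
  | zero => simp
  | add a b ha hb => simp [ha, hb, add_mul]
  | single m a =>
    induction y using Finsupp.induction_linear with
    | zero => simp
    | add a b ha hb => simp [ha, hb, mul_add]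
    | single n b =>
      have h (i : ℕ) (t : ℤ) : Finsupp.single i t = t • Finsupp.single i (1 : ℤ) := by simp
      rw [h m, h n]
      simp only [map_smul, LinearMap.smul_apply, mulSO3_single, dimSOq3_single]
      rw [fusionSO3, map_sum]
      simp only [dimSOq3_single, qNumber_mul q hq, zsmul_eq_mul]
      ring

/-- The fusion algebra `R(SO_q(3))`, `q ∈ (0, 1]`, with the quantum dimension function:
irreducible objects `0, 1, 2, …`, unit `0`, trivial involution, the fusion rules
`m ⊗ n = |m - n| ⊕ ⋯ ⊕ (m + n)` and `d(n) = [2n+1]_q`. -/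
noncomputable def RSOq3 (q : ℝ) (hq : q ∈ Set.Ioc (0 : ℝ) 1) : FusionAlgebra ℕ where
  e := 0
  bar := id
  bar_bar _ := rfl
  mul := mulSO3
  mul_assoc := mulSO3_assoc
  one_mul x := by rw [mulSO3_comm, mulSO3_one]
  mul_one := mulSO3_one
  mul_nonneg ξ η α := by
    rw [mulSO3_single, fusionSO3_apply]
    split_ifs <;> simp
  bar_mul x y := by simp only [Finsupp.mapDomain_id, mulSO3_comm x y]
  frobenius_left ξ η α := by
    simp only [mulSO3_single, fusionSO3_apply, id, Finset.mem_Icc, Nat.dist]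
    congr 1
    apply propext
    omega
  frobenius_right ξ η α := by
    simp only [mulSO3_single, fusionSO3_apply, id, Finset.mem_Icc, Nat.dist]
    congr 1
    apply propext
    omega
  dim := dimSOq3 q
  dim_mul := dimSOq3_mul q hq
  dim_bar _ := rfl
  one_le_dim n := by
    rw [dimSOq3_single]
    exact one_le_qNumber q hq n

/-! ### Supports of products of irreducible objects -/

/-! Only the largest element `M` of a generating set `X` matters for growth. A constituent of a
product of `n` elements of `X` is at most their sum, hence at most `n * M`. Conversely, for `n ≥ 2`
the power `M ⊗ ⋯ ⊗ M` already contains every `k ≤ n * M`. So for `n ≥ 2` the ball of radius `n` is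
exactly `{0, …, n * M}` (`ball_eq`).

The size of `{0, …, N}` equals `q⁻¹ ^ (4 * N)` up to a factor between `1` and `(2 * N + 1) ^ 3`
(`le_size_Iic`, `size_Iic_le`). Polynomial factors disappear under `n`-th roots, so the growth rate
is `q⁻¹ ^ (4 * M)` (`tendsto_ballRoot`). Generation forces `M ≥ 1`, and `{1}` realises `M = 1`;
since `q⁻¹ ≥ 1`, this gives the minimum. -/

theorem mulSO3_single_apply (x : ℕ) (r : ℕ →₀ ℤ) (k : ℕ) :
    mulSO3 (Finsupp.single x 1) r k = ∑ j ∈ r.support, r j * fusionSO3 x j k := by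
  simp [mulSO3, Finsupp.linearCombination_apply, Finsupp.sum, Finsupp.finsetSum_apply]

theorem fusionSO3_nonneg (m n k : ℕ) : 0 ≤ fusionSO3 m n k := by
  rw [fusionSO3_apply]
  split_ifs <;> simp

namespace RSOq3

variable {q : ℝ} {hq : q ∈ Set.Ioc (0 : ℝ) 1}

theorem prod_cons (x : ℕ) (l : List ℕ) :
    (RSOq3 q hq).prod (x :: l) = mulSO3 (Finsupp.single x 1) ((RSOq3 q hq).prod l) := rfl

theorem prod_nil : (RSOq3 q hq).prod [] = Finsupp.single 0 1 := rfl

theorem d_eq (n : ℕ) : (RSOq3 q hq).d n = qNumber q (2 * n + 1) := dimSOq3_single q n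

theorem prod_nonneg (l : List ℕ) (k : ℕ) : 0 ≤ (RSOq3 q hq).prod l k := by
  induction l generalizing k with
  | nil =>
    rw [prod_nil, Finsupp.single_apply]
    split_ifs <;> simp
  | cons x l ih =>
    rw [prod_cons, mulSO3_single_apply]
    exact Finset.sum_nonneg fun j _ => mul_nonneg (ih j) (fusionSO3_nonneg x j k)

theorem le_sum_of_mem_support_prod (l : List ℕ) {k : ℕ}
    (hk : k ∈ ((RSOq3 q hq).prod l).support) : k ≤ l.sum := by
  induction l generalizing k with
  | nil =>
    by_contra h
    rw [prod_nil, Finsupp.mem_support_iff, Finsupp.single_apply] at hk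
    simp at hk h
    omega
  | cons x l ih =>
    rw [Finsupp.mem_support_iff, prod_cons, mulSO3_single_apply] at hk
    obtain ⟨j, hj, hne⟩ := Finset.exists_ne_zero_of_sum_ne_zero hk
    have hf : fusionSO3 x j k ≠ 0 := right_ne_zero_of_mul hne
    rw [fusionSO3_apply] at hf
    have hmem : k ∈ Finset.Icc (Nat.dist x j) (x + j) := by
      by_contra h
      exact hf (if_neg h)
    have := ih hj
    have := (Finset.mem_Icc.mp hmem).2
    rw [List.sum_cons]
    omega

/-- All coefficients are non-negative, so nothing cancels and a single positive contribution
suffices. -/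
theorem mem_support_prod_cons {x j k : ℕ} {l : List ℕ}
    (hj : j ∈ ((RSOq3 q hq).prod l).support) (hk : k ∈ Finset.Icc (Nat.dist x j) (x + j)) :
    k ∈ ((RSOq3 q hq).prod (x :: l)).support := by
  rw [Finsupp.mem_support_iff, prod_cons, mulSO3_single_apply]
  apply ne_of_gt
  refine Finset.sum_pos' (fun i _ => mul_nonneg (prod_nonneg l i) (fusionSO3_nonneg x i k))
    ⟨j, hj, ?_⟩
  rw [fusionSO3_apply, if_pos hk, mul_one]
  exact lt_of_le_of_ne (prod_nonneg l j) (Finsupp.mem_support_iff.mp hj).symm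

/-- The bound `2 ≤ n` is needed because the first power contains only `M`, whereas `M ⊗ M` already
fills `{0, …, 2 * M}`. -/
theorem mem_support_prod_replicate (M n : ℕ) (hn : 2 ≤ n) {k : ℕ} (hk : k ≤ n * M) :
    k ∈ ((RSOq3 q hq).prod (List.replicate n M)).support := by
  induction n, hn using Nat.le_induction generalizing k with
  | base =>
    have h0 : 0 ∈ ((RSOq3 q hq).prod []).support := by simp [prod_nil]
    have h1 : M ∈ ((RSOq3 q hq).prod [M]).support :=
      mem_support_prod_cons h0 (by simp [Nat.dist])
    exact mem_support_prod_cons h1 (by simp [Nat.dist]; omega)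
  | succ n hn ih =>
    have h2 : 2 * M ≤ n * M := Nat.mul_le_mul_right M hn
    rw [add_mul, one_mul] at hk
    -- The witness in the previous power is `|k - M|`: it is in range, and `k` always occurs in `M ⊗
    -- |k - M|`.
    have hd : Nat.dist k M ≤ n * M := by simp only [Nat.dist]; omega
    rw [List.replicate_succ]
    exact mem_support_prod_cons (ih hd) (by simp only [Finset.mem_Icc, Nat.dist]; omega)

/-! ### Balls -/

theorem le_of_containedInPower {X : Finset ℕ} {n k : ℕ}
    (h : (RSOq3 q hq).ContainedInPower X n k) : k ≤ n * X.sup id := by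
  obtain ⟨l, rfl, hX, hk⟩ := h
  refine (le_sum_of_mem_support_prod l hk).trans ?_
  simpa using l.sum_le_card_nsmul (X.sup id) fun x hx => Finset.le_sup (f := id) (hX x hx)

theorem one_le_sup {X : Finset ℕ} (hX : (RSOq3 q hq).Generates X) : 1 ≤ X.sup id := by
  obtain ⟨n, -, hn⟩ := hX.2 1
  have h := le_of_containedInPower hn
  by_contra h0
  have : X.sup id = 0 := by omega
  simp [this] at h

theorem sup_mem {X : Finset ℕ} (hX : (RSOq3 q hq).Generates X) : X.sup id ∈ X := by
  have hne : X.Nonempty := by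
    rw [Finset.nonempty_iff_ne_empty]
    rintro rfl
    simpa using one_le_sup hX
  obtain ⟨x, hx, h⟩ := Finset.exists_mem_eq_sup X hne id
  rw [h]
  exact hx

theorem containedInPower_of_le {X : Finset ℕ} {M n k : ℕ} (hM : M ∈ X) (hn : 2 ≤ n)
    (hk : k ≤ n * M) : (RSOq3 q hq).ContainedInPower X n k :=
  ⟨List.replicate n M, List.length_replicate,
    fun _ hx => (List.eq_of_mem_replicate hx).symm ▸ hM, mem_support_prod_replicate M n hn hk⟩

theorem generates_singleton_one : (RSOq3 q hq).Generates {1} :=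
  -- The exponent `α + 2` instead of `α` keeps it at least `2`, also for `α = 0` and `α = 1`.
  ⟨fun _ hx => hx, fun α => ⟨α + 2, by omega,
    containedInPower_of_le (Finset.mem_singleton_self 1) (by omega) (by omega)⟩⟩

theorem ball_subset {X : Finset ℕ} (hX : (RSOq3 q hq).Generates X) (n : ℕ) :
    (RSOq3 q hq).ball X n ⊆ Set.Iic (n * X.sup id) := by
  intro k hk
  change (RSOq3 q hq).length X k ≤ n at hk
  rw [Set.mem_Iic]
  rw [FusionAlgebra.length] at hk
  split_ifs at hk with h
  · have : k = 0 := h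
    omega
  -- Generation makes the set of exponents nonempty, so the length is an attained minimum and not
  -- the default value `0` of `sInf`.
  · have hmem := (Nat.sInf_mem (hX.2 k)).2
    exact (le_of_containedInPower hmem).trans (Nat.mul_le_mul_right _ hk)

theorem ball_eq {X : Finset ℕ} (hX : (RSOq3 q hq).Generates X) {n : ℕ} (hn : 2 ≤ n) :
    (RSOq3 q hq).ball X n = Set.Iic (n * X.sup id) := by
  refine (ball_subset hX n).antisymm fun k hk => ?_
  change (RSOq3 q hq).length X k ≤ n
  rw [FusionAlgebra.length]
  split_ifs
  · exact Nat.zero_le n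
  · exact Nat.sInf_le ⟨by omega, containedInPower_of_le (sup_mem hX) hn hk⟩

end RSOq3

/-! ### Estimates for the dimensions and the sizes of balls -/

theorem qNumber_add_two (q : ℝ) (hq : q ∈ Set.Ioc (0 : ℝ) 1) (k : ℕ) :
    qNumber q (k + 2) = qNumber q k + q⁻¹ ^ (k + 1) + q ^ (k + 1) := by
  rcases eq_or_ne q 1 with rfl | h1
  · simp only [qNumber, if_true]
    push_cast
    simp
    ring
  · have hinv := one_lt_inv_iff₀.mpr ⟨hq.1, lt_of_le_of_ne hq.2 h1⟩
    have hD : q⁻¹ - q ≠ 0 := by linarith [hq.2]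
    have hp : q⁻¹ * q = 1 := inv_mul_cancel₀ hq.1.ne'
    simp only [qNumber, if_neg h1]
    generalize q⁻¹ = p at *
    field_simp
    linear_combination (p ^ k - q ^ k) * hp

/-- `[2k+1]_q` is the sum of the `2k+1` powers `q^(-2k), q^(-2k+2), …, q^(2k)`, of which the first
is the largest. Each induction step adds the two outer terms. -/
theorem qNumber_bounds (q : ℝ) (hq : q ∈ Set.Ioc (0 : ℝ) 1) (k : ℕ) :
    q⁻¹ ^ (2 * k) ≤ qNumber q (2 * k + 1) ∧
      qNumber q (2 * k + 1) ≤ (2 * k + 1) * q⁻¹ ^ (2 * k) := by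
  have hp : 1 ≤ q⁻¹ := one_le_inv_iff₀.mpr hq
  induction k with
  | zero =>
    have h : qNumber q 1 = 1 := by
      rcases eq_or_ne q 1 with rfl | h1
      · simp [qNumber]
      · have hinv := one_lt_inv_iff₀.mpr ⟨hq.1, lt_of_le_of_ne hq.2 h1⟩
        have hD : q⁻¹ - q ≠ 0 := by linarith [hq.2]
        simp only [qNumber, if_neg h1, pow_one]
        exact div_self hD
    simp [h]
  | succ k ih =>
    have h := qNumber_add_two q hq (2 * k + 1)
    have e : 2 * (k + 1) + 1 = 2 * k + 1 + 2 := by ring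
    have e' : 2 * k + 1 + 1 = 2 * (k + 1) := by ring
    rw [e, h, e']
    have h1 : 1 ≤ q⁻¹ ^ (2 * (k + 1)) := one_le_pow₀ hp
    have h2 : q ^ (2 * (k + 1)) ≤ 1 := pow_le_one₀ hq.1.le hq.2
    have h3 : 0 < q ^ (2 * (k + 1)) := pow_pos hq.1 _
    have h4 : q⁻¹ ^ (2 * k) ≤ q⁻¹ ^ (2 * (k + 1)) := pow_le_pow_right₀ hp (by omega)
    have h5 := mul_le_mul_of_nonneg_left h4 (by positivity : (0 : ℝ) ≤ 2 * k + 1)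
    have h6 : 1 ≤ qNumber q (2 * k + 1) := one_le_qNumber q hq k
    constructor
    · linarith
    · push_cast
      linarith [ih.2]

namespace RSOq3

variable {q : ℝ} {hq : q ∈ Set.Ioc (0 : ℝ) 1}

theorem size_Iic (N : ℕ) :
    (RSOq3 q hq).size (Set.Iic N) = ∑ k ∈ Finset.Iic N, qNumber q (2 * k + 1) ^ 2 := by
  simp only [FusionAlgebra.size, d_eq]
  rw [← Finset.coe_Iic, finsum_mem_coe_finset]

theorem le_size_Iic (N : ℕ) : q⁻¹ ^ (4 * N) ≤ (RSOq3 q hq).size (Set.Iic N) := by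
  rw [size_Iic]
  have hp : 0 ≤ q⁻¹ := inv_nonneg.mpr hq.1.le
  calc q⁻¹ ^ (4 * N) = (q⁻¹ ^ (2 * N)) ^ 2 := by ring
    _ ≤ qNumber q (2 * N + 1) ^ 2 :=
      pow_le_pow_left₀ (pow_nonneg hp _) (qNumber_bounds q hq N).1 2
    _ ≤ _ := Finset.single_le_sum (f := fun k => qNumber q (2 * k + 1) ^ 2)
      (fun k _ => sq_nonneg _) (Finset.mem_Iic.mpr le_rfl)

theorem size_Iic_le (N : ℕ) :
    (RSOq3 q hq).size (Set.Iic N) ≤ (2 * N + 1 : ℝ) ^ 3 * q⁻¹ ^ (4 * N) := by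
  rw [size_Iic]
  have hp : 1 ≤ q⁻¹ := one_le_inv_iff₀.mpr hq
  have hp0 : 0 < q⁻¹ := by linarith
  have hterm : ∀ k ∈ Finset.Iic N,
      qNumber q (2 * k + 1) ^ 2 ≤ ((2 * N + 1 : ℝ) * q⁻¹ ^ (2 * N)) ^ 2 := by
    intro k hk
    have hkN : k ≤ N := Finset.mem_Iic.mp hk
    have hkN' : (k : ℝ) ≤ N := by exact_mod_cast hkN
    refine pow_le_pow_left₀ (zero_le_one.trans (one_le_qNumber q hq k)) ?_ 2
    refine (qNumber_bounds q hq k).2.trans ?_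
    exact mul_le_mul (by linarith) (pow_le_pow_right₀ hp (by omega)) (by positivity)
      (by positivity)
  refine (Finset.sum_le_card_nsmul _ _ _ hterm).trans ?_
  rw [Nat.card_Iic, nsmul_eq_mul]
  -- Weakening the number of terms `N + 1` to `2 * N + 1` makes the polynomial factor a pure cube,
  -- so one limit of `n`-th roots handles it.
  calc ((N + 1 : ℕ) : ℝ) * ((2 * N + 1 : ℝ) * q⁻¹ ^ (2 * N)) ^ 2
      ≤ (2 * N + 1 : ℝ) * ((2 * N + 1 : ℝ) * q⁻¹ ^ (2 * N)) ^ 2 := by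
        refine mul_le_mul_of_nonneg_right ?_ (by positivity)
        push_cast
        linarith [N.cast_nonneg (α := ℝ)]
    _ = _ := by ring

end RSOq3

/-! ### Growth rates -/

theorem tendsto_linear_rpow_one_div (M : ℕ) (hM : 1 ≤ M) :
    Tendsto (fun n : ℕ => (2 * ((n * M : ℕ) : ℝ) + 1) ^ (1 / (n : ℝ))) atTop (𝓝 1) := by
  have hM' : (0 : ℝ) < M := by exact_mod_cast hM
  have hlin : Tendsto (fun n : ℕ => 2 * ((n * M : ℕ) : ℝ) + 1) atTop atTop := by
    refine tendsto_atTop_add_const_right _ _ (Tendsto.const_mul_atTop two_pos ?_)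
    push_cast
    exact tendsto_natCast_atTop_atTop.atTop_mul_const hM'
  -- With `x = 2 * n * M + 1`, the exponent `1 / n` equals `2 * M / (x - 1)`.
  have h := (tendsto_rpow_div_mul_add (2 * M) 1 (-1) one_ne_zero.symm).comp hlin
  refine h.congr' ?_
  filter_upwards [eventually_ge_atTop 1] with n hn
  have hn' : (0 : ℝ) < n := by exact_mod_cast hn
  simp only [Function.comp_apply]
  congr 1
  push_cast
  field_simp
  ring

namespace RSOq3

variable {q : ℝ} {hq : q ∈ Set.Ioc (0 : ℝ) 1}

theorem tendsto_ballRoot {X : Finset ℕ} (hX : (RSOq3 q hq).Generates X) :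
    Tendsto ((RSOq3 q hq).ballRoot X) atTop (𝓝 (q⁻¹ ^ (4 * X.sup id))) := by
  have hp0 : 0 < q⁻¹ := inv_pos.mpr hq.1
  set M := X.sup id with hMdef
  have hroot (n : ℕ) (hn : n ≠ 0) :
      (q⁻¹ ^ (4 * (n * M))) ^ (1 / (n : ℝ)) = q⁻¹ ^ (4 * M) := by
    rw [one_div, show 4 * (n * M) = 4 * M * n by ring, pow_mul,
      Real.pow_rpow_inv_natCast (by positivity) hn]
  have hup : Tendsto (fun n : ℕ =>
      ((2 * ((n * M : ℕ) : ℝ) + 1) ^ (1 / (n : ℝ))) ^ 3 * q⁻¹ ^ (4 * M)) atTop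
      (𝓝 (q⁻¹ ^ (4 * M))) := by
    simpa using ((tendsto_linear_rpow_one_div M (one_le_sup hX)).pow 3).mul_const (q⁻¹ ^ (4 * M))
  refine tendsto_of_tendsto_of_tendsto_of_le_of_le' tendsto_const_nhds hup ?_ ?_
  · filter_upwards [eventually_ge_atTop 2] with n hn
    rw [FusionAlgebra.ballRoot, ball_eq hX hn, ← hroot n (by omega)]
    exact Real.rpow_le_rpow (by positivity) (le_size_Iic _) (by positivity)
  · filter_upwards [eventually_ge_atTop 2] with n hn
    rw [FusionAlgebra.ballRoot, ball_eq hX hn, ← hroot n (by omega)]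
    refine (Real.rpow_le_rpow (le_trans (by positivity) (le_size_Iic _)) (size_Iic_le _)
      (by positivity)).trans_eq ?_
    rw [Real.mul_rpow (by positivity) (by positivity), Real.rpow_pow_comm (by positivity)]

theorem growthRate_eq {X : Finset ℕ} (hX : (RSOq3 q hq).Generates X) :
    (RSOq3 q hq).growthRate X = q⁻¹ ^ (4 * X.sup id) :=
  (tendsto_ballRoot hX).limUnder_eq

theorem isLeast_growthRates : IsLeast (RSOq3 q hq).growthRates (q⁻¹ ^ 4) := by
  constructor
  · exact ⟨{1}, generates_singleton_one, by simp [growthRate_eq generates_singleton_one]⟩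
  · rintro _ ⟨X, hX, rfl⟩
    rw [growthRate_eq hX]
    exact pow_le_pow_right₀ (one_le_inv_iff₀.mpr hq) (by have := one_le_sup hX; omega)

end RSOq3

/-- For `q ∈ (0, 1]`: all exponential growth rates of `R(SO_q(3))` are well defined (balls are
finite, the limits exist, the infimum is a genuine one), the uniform exponential growth rate is
`q⁻⁴`, and it is attained at the generating set `{1}`. -/
theorem proposition15 (q : ℝ) (hq : q ∈ Set.Ioc (0 : ℝ) 1) :
    (∀ X : Finset ℕ, (RSOq3 q hq).Generates X →
      (∀ n, ((RSOq3 q hq).ball X n).Finite) ∧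
      Tendsto ((RSOq3 q hq).ballRoot X) atTop (𝓝 ((RSOq3 q hq).growthRate X))) ∧
    IsGLB (RSOq3 q hq).growthRates (RSOq3 q hq).uniformGrowthRate ∧
    (RSOq3 q hq).uniformGrowthRate = q ^ (-4 : ℤ) ∧
    (RSOq3 q hq).Generates {1} ∧
    (RSOq3 q hq).growthRate {1} = q ^ (-4 : ℤ) := by
  have hpow : q ^ (-4 : ℤ) = q⁻¹ ^ 4 := by
    rw [zpow_neg, inv_pow]
    norm_cast
  have hleast := RSOq3.isLeast_growthRates (hq := hq)
  -- A least element ensures that the real `sInf` is a true infimum.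
  have hunif : (RSOq3 q hq).uniformGrowthRate = q⁻¹ ^ 4 := hleast.csInf_eq
  refine ⟨fun X hX => ⟨fun n => (Set.finite_Iic _).subset (RSOq3.ball_subset hX n), ?_⟩, ?_, ?_,
    RSOq3.generates_singleton_one, ?_⟩
  · rw [RSOq3.growthRate_eq hX]
    exact RSOq3.tendsto_ballRoot hX
  · rw [hunif]
    exact hleast.isGLB
  · rw [hunif, hpow]
  · rw [hpow, RSOq3.growthRate_eq RSOq3.generates_singleton_one]
    simp
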